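/- **Online learnability of multilabel ranking.** Let $\mathcal{X}$ be a nonempty instance space, $K\in\mathbb{N}$, let $\mathcal{Y}$ be the set of permutations of $[K]=\{1,\dots,K\}$ (where $\pi^i$ is the rank of label $i$ under $\pi$) and $\mathcal{R}=\{0,1\}^K$. For $\pi\in\mathcal{Y}$ and $r\in\mathcal{R}$ let $\ell_{0\text{-}1}(\pi,r)=\sup_{i,j\in[K]}\mathbf{1}\{r^i<r^j\}\mathbf{1}\{\pi^i<\pi^j\}$, $\mathcal{Y}(r)=\{\pi\in\mathcal{Y}:\ell_{0\text{-}1}(\pi,r)=0\}$ and $\mathcal{S}(\mathcal{Y})=\{\mathcal{Y}(r):r\in\mathcal{R}\}$. Let $\mathcal{H}\subseteq\mathcal{Y}^{\mathcal{X}}$ be a nonempty ranking hypothesis class. *Dimension.* A complete binary tree of depth $d$, given by node labels $\mathcal{T}_t:\{1,2\}^{t-1}\to\mathcal{X}$ for $1\le t\le d$, is shattered by $\mathcal{H}$ if there are edge labels $f_t:\{1,2\}^t\to\mathcal{S}(\mathcal{Y})$ such that for every path $q\in\{1,2\}^d$ and every $t\le d$ we have $f_t(q_{<t},1)\cap f_t(q_{<t},2)=\emptyset$,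 and for every path $q$ there is $h_q\in\mathcal{H}$ with $h_q(\mathcal{T}_t(q_{<t}))\in f_t(q_{\le t})$ for all $t\le d$. The 2-Set Littlestone dimension $\mathrm{SL}_2(\mathcal{H})\in\{0,1,2,\dots\}\cup\{\infty\}$ is the maximal depth of a shattered tree ($\infty$ if there are shattered trees of arbitrarily large depth). *Learning.* A (randomized) online learner $\mathcal{A}$ maps each finite sequence of past examples in $\mathcal{X}\times\mathcal{S}(\mathcal{Y})$ and a new instance in $\mathcal{X}$ to a probability distribution on $\mathcal{Y}$, from which its prediction $\mathcal{A}(x_t)$ is drawn in round $t$. For a horizon $T\ge 0$ put $$\mathrm{M}_{\mathcal{A}}(T,\mathcal{H})=\sup\ \mathbb{E}\Big[\sum_{t=1}^T\mathbf{1}\{\mathcal{A}(x_t)\notin S_t\}\Big],$$ the supremum being over the streams $(x_1,S_1),\dots,(x_T,S_T)\in\mathcal{X}\times\mathcal{S}(\mathcal{Y})$ for which some $h^\star\in\mathcal{H}$ satisfies $h^\star(x_t)\in S_t$ for all $t$, and $$\mathrm{R}_{\mathcal{A}}(T,\mathcal{H})=\sup\ \mathbb{E}\Big[\sum_{t=1}^T\mathbf{1}\{\mathcal{A}(x_t)\notin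 S_t\}-\inf_{h\in\mathcal{H}}\sum_{t=1}^T\mathbf{1}\{h(x_t)\notin S_t\}\Big],$$ the supremum being over all streams of length $T$ in $\mathcal{X}\times\mathcal{S}(\mathcal{Y})$. *Claim.* For every $T\ge 0$, with infima over all randomized online learners (which may depend on $T$), 1. $\displaystyle \frac{\min\{\mathrm{SL}_2(\mathcal{H}),T\}}{2}\ \le\ \inf_{\mathcal{A}}\mathrm{M}_{\mathcal{A}}(T,\mathcal{H})\ \le\ \mathrm{SL}_2(\mathcal{H})$; 2. $\displaystyle \sqrt{\frac{\min\{\mathrm{SL}_2(\mathcal{H}),T\}\,T}{8}}\ \le\ \inf_{\mathcal{A}}\mathrm{R}_{\mathcal{A}}(T,\mathcal{H})\ \le\ \mathrm{SL}_2(\mathcal{H})+\sqrt{2\,\mathrm{SL}_2(\mathcal{H})\,T\ln T}$ (with $T\ln T=0$ for $T=0$; the upper bounds are void when $\mathrm{SL}_2(\mathcal{H})=\infty$). In particular, if $T\ge\mathrm{SL}_2(\mathcal{H})$ the lower bounds are $\mathrm{SL}_2(\mathcal{H})/2$ and $\sqrt{\mathrm{SL}_2(\mathcal{H})\,T/8}$.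 None of the bounds depends on $K$. -/

import Mathlib

open scoped ENNReal

namespace SetFeedback

/-! ### Trees and the `p`-Set Littlestone dimension -/

section Dimension

variable {X Y : Type*}

/-- An `X`-valued complete `[p]`-ary tree of depth `d` is represented by a labelling of words over
`Fin p`: the internal node reached by following the edges `u` is labelled by `tree u`, and only the
words of length `< d` matter.  Likewise the edge with which a nonempty word `u` of length `≤ d` ends
is labelled by the set `f u`.  The tree is shattered by `H` if its edges can be labelled by sets of
the system `S` such that the `p` sets leaving every internal node have empty intersection and every
root-to-leaf path `q` is followed by some hypothesis of `H`. -/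
def Shatters (p : ℕ) (S : Set (Set Y)) (H : Set (X → Y)) (d : ℕ) (tree : List (Fin p) → X) : Prop :=
  ∃ f : List (Fin p) → Set Y,
    (∀ u : List (Fin p), u ≠ [] → u.length ≤ d → f u ∈ S) ∧
    (∀ u : List (Fin p), u.length < d → ⋂ i : Fin p, f (u ++ [i]) = ∅) ∧
    (∀ q : List (Fin p), q.length = d →
      ∃ h ∈ H, ∀ t < d, h (tree (q.take t)) ∈ f (q.take (t + 1)))

/-- The `p`-Set Littlestone dimension of `H` with respect to the set system `S`: the maximal depth
of a `[p]`-ary tree shattered by `H`, and `⊤` if there are shattered trees of arbitrary depth. -/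
noncomputable def setLittlestoneDim (p : ℕ) (S : Set (Set Y)) (H : Set (X → Y)) : ℕ∞ :=
  ⨆ (d : ℕ) (_ : ∃ tree : List (Fin p) → X, Shatters p S H d tree), (d : ℕ∞)

end Dimension

/-! ### Online learning with set-valued feedback -/

section Online

variable {X Y : Type*}

/-- The loss `1{y ∉ A}` of the prediction `y` when the set `A` is revealed. -/
noncomputable def setLoss (y : Y) (A : Set Y) : ℝ :=
  Aᶜ.indicator 1 y

/-- A randomized online learner: a map from the past labelled examples (in chronological order)
and the newly revealed instance to a probability distribution on the label space. -/
abbrev RandomizedLearner (X Y : Type*) (S : Set (Set Y)) : Type _ :=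
  List (X × S) → X → PMF Y

/-- The distribution that the learner uses for its prediction in round `t` on the stream `z`. -/
noncomputable def prediction {S : Set (Set Y)} {T : ℕ} (A : RandomizedLearner X Y S)
    (z : Fin T → X × S) (t : Fin T) : PMF Y :=
  A ((List.ofFn z).take t) (z t).1

/-- The expected number of mistakes of the learner `A` on the stream `z`, the prediction of round
`t` being drawn from `prediction A z t`.  See `integral_sum_setLoss`. -/
noncomputable def expectedLoss [Fintype Y] {S : Set (Set Y)} {T : ℕ} (A : RandomizedLearner X Y S)
    (z : Fin T → X × S) : ℝ :=
  ∑ t, ∑ y, (prediction A z t y).toReal * setLoss y (z t).2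

/-- For random predictions `yhat t`, on any probability space, whose laws are those chosen by the
learner, `expectedLoss A z` is the expectation of the number of mistakes. -/
theorem integral_sum_setLoss [Fintype Y] [MeasurableSpace Y] [MeasurableSingletonClass Y]
    {S : Set (Set Y)} {T : ℕ} (A : RandomizedLearner X Y S) (z : Fin T → X × S)
    {Ω : Type*} [MeasurableSpace Ω] (P : MeasureTheory.Measure Ω)
    [MeasureTheory.IsProbabilityMeasure P] (yhat : Fin T → Ω → Y)
    (hm : ∀ t, Measurable (yhat t))
    (hlaw : ∀ t, P.map (yhat t) = (prediction A z t).toMeasure) :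
    ∫ ω, ∑ t, setLoss (yhat t ω) (z t).2 ∂P = expectedLoss A z := by
  have key : ∀ t, ∫ ω, setLoss (yhat t ω) (z t).2 ∂P =
      ∑ y, (prediction A z t y).toReal * setLoss y (z t).2 := by
    intro t
    have h := MeasureTheory.integral_map (μ := P) (hm t).aemeasurable
      (f := fun y => setLoss y ((z t).2 : Set Y)) (measurable_of_finite _).aestronglyMeasurable
    rw [← h, hlaw t, PMF.integral_eq_sum]
    simp only [smul_eq_mul]
  rw [MeasureTheory.integral_finsetSum]
  · exact Finset.sum_congr rfl fun t _ => key t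
  · intro t _
    have hf : MeasureTheory.Integrable (fun y => setLoss y ((z t).2 : Set Y)) (P.map (yhat t)) := by
      rw [hlaw t]
      exact MeasureTheory.Integrable.of_finite
    exact hf.comp_measurable (hm t)

/-- The number of mistakes of the best fixed hypothesis of `H` on the stream `z`. -/
noncomputable def bestLoss {S : Set (Set Y)} {T : ℕ} (H : Set (X → Y)) (z : Fin T → X × S) : ℝ :=
  ⨅ h : H, ∑ t, setLoss (h.1 (z t).1) (z t).2

/-- The stream `z` is realizable by `H`. -/
def Realizable {S : Set (Set Y)} {T : ℕ} (H : Set (X → Y)) (z : Fin T → X × S) : Prop :=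
  ∃ h ∈ H, ∀ t, h (z t).1 ∈ ((z t).2 : Set Y)

/-- The worst-case expected number of mistakes of `A` over realizable streams of length `T`. -/
noncomputable def mistakes [Fintype Y] {S : Set (Set Y)} (A : RandomizedLearner X Y S) (T : ℕ)
    (H : Set (X → Y)) : EReal :=
  ⨆ (z : Fin T → X × S) (_ : Realizable H z), ((expectedLoss A z : ℝ) : EReal)

/-- The worst-case expected regret of `A` over all streams of length `T`. -/
noncomputable def regret [Fintype Y] {S : Set (Set Y)} (A : RandomizedLearner X Y S) (T : ℕ)
    (H : Set (X → Y)) : EReal :=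
  ⨆ z : Fin T → X × S, ((expectedLoss A z - bestLoss H z : ℝ) : EReal)

end Online

/-! ### Multilabel ranking -/

/-- The 0-1 ranking loss of the permutation `π` (with `π i` the rank of label `i`) against the
binary relevance-score vector `r`. -/
def rankingLoss {K : ℕ} (π : Equiv.Perm (Fin K)) (r : Fin K → Fin 2) : ℕ :=
  Finset.univ.sup fun i => Finset.univ.sup fun j =>
    (if r i < r j then 1 else 0) * (if π i < π j then 1 else 0)

/-- The permutations with zero ranking loss against `r`. -/
def correctRankings {K : ℕ} (r : Fin K → Fin 2) : Set (Equiv.Perm (Fin K)) :=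
  {π | rankingLoss π r = 0}

/-- The set system of multilabel ranking over `K` labels. -/
def rankingSets (K : ℕ) : Set (Set (Equiv.Perm (Fin K))) :=
  Set.range correctRankings

/-- The 2-Set Littlestone dimension of a ranking hypothesis class, as an extended real. -/
noncomputable def rankingDim {X : Type*} {K : ℕ} (H : Set (X → Equiv.Perm (Fin K))) : ℝ≥0∞ :=
  (setLittlestoneDim 2 (rankingSets K) H : ℝ≥0∞)

end SetFeedback

/-! Everything rests on a Helly property (`hasHellyTwo_rankingSets`): pairwise intersecting ranking
sets have a common permutation. This is why binary trees suffice and `K` never enters. Upper bounds.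
Call a set heavy at `x` if revealing it leaves the dimension `d` of the version space unchanged. Two
disjoint heavy sets would give a shattered tree of depth `d + 1`, so heavy sets pairwise intersect
and one prediction lies in all of them. A mistake then lowers the dimension, and at most `SL₂`
mistakes occur. In the agnostic case, fix a comparator `h` and update only in the rounds where `h`
is right and the algorithm errs. There are at most `d` such rounds, and elsewhere the algorithm does
no worse than `h` (`exists_soaLearner_le`). Hedging over all sets of at most `d` update rounds, at
most `(T + 1) ^ d` experts, costs the square-root term. Lower bounds. At a node of a shattered tree
any prediction misses one of two disjoint sets, so some branch costs at least `1/2` per level. For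
regret, each level is repeated over a block of `k` rounds with signs choosing the branch. The
learner loses `k/2` on average, while the majority branch saves half the absolute sign sum. A sharp
Khinchine estimate for block sizes as equal as parity allows gives the constant `8`. Averaging
arguments replace the random signs by a fixed word. -/

namespace SetFeedback

/-! ### Shattered trees by recursion on the depth -/

section Recursion

variable {X Y : Type*}

/-- The hypotheses of `V` whose value at `x` lies in `B`. -/
def refine (V : Set (X → Y)) (x : X) (B : Set Y) : Set (X → Y) :=
  {h | h ∈ V ∧ h x ∈ B}

/-- Some binary tree of depth `d` is shattered by `V`, by recursion on the depth. -/
def ShatterDepth (S : Set (Set Y)) : ℕ → Set (X → Y) → Prop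
  | 0, V => V.Nonempty
  | d + 1, V => ∃ (x : X) (B : Fin 2 → Set Y), (∀ i, B i ∈ S) ∧ Disjoint (B 0) (B 1) ∧
      ∀ i, ShatterDepth S d (refine V x (B i))

theorem iInter_fin_two_eq_empty (B : Fin 2 → Set Y) :
    ⋂ i, B i = ∅ ↔ Disjoint (B 0) (B 1) := by
  rw [Set.disjoint_iff_inter_eq_empty]
  have : ⋂ i, B i = B 0 ∩ B 1 := by
    ext y; simp [Fin.forall_fin_two]
  rw [this]

theorem ShatterDepth.of_tree {S : Set (Set Y)} {d : ℕ} {V : Set (X → Y)}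
    {tree : List (Fin 2) → X} (hs : Shatters 2 S V d tree) : ShatterDepth S d V := by
  induction d generalizing V tree with
  | zero =>
    obtain ⟨f, -, -, hf⟩ := hs
    obtain ⟨h, hh, -⟩ := hf [] rfl
    exact ⟨h, hh⟩
  | succ d ih =>
    obtain ⟨f, hS, hdisj, hpath⟩ := hs
    refine ⟨tree [], fun i => f [i], fun i => hS _ (by simp) (by simp), ?_, fun i => ?_⟩
    · exact (iInter_fin_two_eq_empty _).1 (hdisj [] (by simp))
    · refine ih (tree := fun u => tree (i :: u)) ⟨fun u => f (i :: u), fun u hu hl => ?_, fun u hl => ?_,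
        fun q hq => ?_⟩
      · exact hS _ (by simp) (by simpa using hl)
      · exact hdisj (i :: u) (by simpa using hl)
      · obtain ⟨h, hh, ht⟩ := hpath (i :: q) (by simpa using hq)
        refine ⟨h, ⟨hh, by simpa using ht 0 (by simp)⟩, fun t htd => ?_⟩
        simpa using ht (t + 1) (by omega)

theorem ShatterDepth.exists_tree [Nonempty X] {S : Set (Set Y)} {d : ℕ} {V : Set (X → Y)}
    (hs : ShatterDepth S d V) : ∃ tree : List (Fin 2) → X, Shatters 2 S V d tree := by
  induction d generalizing V with
  | zero =>
    obtain ⟨h, hh⟩ := hs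
    refine ⟨fun _ => Classical.arbitrary X, fun _ => ∅, fun u hu hl => ?_, fun u hl => ?_,
      fun q hq => ⟨h, hh, fun t ht => ?_⟩⟩
    · exact absurd (List.length_eq_zero_iff.1 (Nat.le_zero.1 hl)) hu
    · omega
    · omega
  | succ d ih =>
    obtain ⟨x, B, hB, hdisj, hch⟩ := hs
    choose tr htr using fun i => ih (hch i)
    choose f hS hdis hpath using htr
    -- No edge ends with the empty word, so `f i []` is unconstrained in the subtree. The edge from
    -- the new root to child `i` takes its place and gets the label `B i`; the outer `∅` is a dummy
    -- value.
    refine ⟨fun u => u.casesOn x (fun i v => tr i v),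
      fun u => u.casesOn ∅ (fun i v => if v = [] then B i else f i v), ?_, ?_, ?_⟩
    · rintro (_ | ⟨i, v⟩) hu hl
      · exact absurd rfl hu
      · by_cases hv : v = []
        · simpa [hv] using hB i
        · simpa [hv] using hS i v hv (by simpa using hl)
    · rintro (_ | ⟨i, v⟩) hl
      · simpa using (iInter_fin_two_eq_empty B).2 hdisj
      · simpa using hdis i v (by simpa using hl)
    · rintro (_ | ⟨i, v⟩) hl
      · simp at hl
      · obtain ⟨h, hh, ht⟩ := hpath i v (by simpa using hl)
        refine ⟨h, hh.1, fun t htd => ?_⟩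
        cases t with
        | zero => simpa using hh.2
        | succ t =>
          have htd' : t < d := by omega
          have hne : v.take (t + 1) ≠ [] := by
            have hl' : v.length = d := by simpa using hl
            intro h0
            rcases List.take_eq_nil_iff.1 h0 with h0 | h0
            · omega
            · simp [h0] at hl'
              omega
          have := ht t htd'
          simpa [hne] using this

theorem ShatterDepth.mono {S : Set (Set Y)} {d : ℕ} {V W : Set (X → Y)} (hVW : V ⊆ W)
    (hs : ShatterDepth S d V) : ShatterDepth S d W := by
  induction d generalizing V W with
  | zero => exact Set.Nonempty.mono hVW hs
  | succ d ih =>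
    obtain ⟨x, B, hB, hdisj, hch⟩ := hs
    exact ⟨x, B, hB, hdisj, fun i => ih (fun h hh => ⟨hVW hh.1, hh.2⟩) (hch i)⟩

theorem ShatterDepth.pred {S : Set (Set Y)} {d : ℕ} {V : Set (X → Y)}
    (hs : ShatterDepth S (d + 1) V) : ShatterDepth S d V := by
  obtain ⟨x, B, -, -, hch⟩ := hs
  exact (hch 0).mono fun h hh => hh.1

theorem ShatterDepth.anti {S : Set (Set Y)} {c d : ℕ} {V : Set (X → Y)} (hcd : c ≤ d)
    (hs : ShatterDepth S d V) : ShatterDepth S c V := by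
  induction hcd with
  | refl => exact hs
  | step _ ih => exact ih hs.pred

/-- The depths of shattered trees are closed downwards, so a depth that is not shattered bounds all
shattered depths strictly. Nonemptiness of `H` takes care of depth `0`. -/
theorem le_setLittlestoneDim_iff [Nonempty X] {S : Set (Set Y)} {H : Set (X → Y)}
    (hH : H.Nonempty) (d : ℕ) :
    (d : ℕ∞) ≤ setLittlestoneDim 2 S H ↔ ShatterDepth S d H := by
  constructor
  · intro hle
    by_contra hn
    have hd : d ≠ 0 := by
      rintro rfl
      exact hn hH
    have : setLittlestoneDim 2 S H ≤ ((d - 1 : ℕ) : ℕ∞) := by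
      refine iSup₂_le fun c ⟨tree, hc⟩ => ?_
      have : c < d := by
        by_contra hcd
        exact hn ((ShatterDepth.of_tree hc).anti (not_lt.1 hcd))
      exact_mod_cast (by omega : c ≤ d - 1)
    have := hle.trans this
    have : d ≤ d - 1 := by exact_mod_cast this
    omega
  · intro hs
    exact le_iSup₂_of_le d hs.exists_tree le_rfl

end Recursion

/-! ### Losses of fixed hypotheses -/

section HypothesisLoss

variable {X Y : Type*} {S : Set (Set Y)}

theorem setLoss_of_mem {y : Y} {B : Set Y} (h : y ∈ B) : setLoss y B = 0 := by
  simp [setLoss, h]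

theorem setLoss_of_notMem {y : Y} {B : Set Y} (h : y ∉ B) : setLoss y B = 1 := by
  simp [setLoss, h]

theorem setLoss_nonneg (y : Y) (B : Set Y) : 0 ≤ setLoss y B := by
  by_cases h : y ∈ B
  · simp [setLoss_of_mem h]
  · simp [setLoss_of_notMem h]

theorem setLoss_le_one (y : Y) (B : Set Y) : setLoss y B ≤ 1 := by
  by_cases h : y ∈ B
  · simp [setLoss_of_mem h]
  · simp [setLoss_of_notMem h]

/-- The number of mistakes of the hypothesis `h` on the examples `zs`. -/
noncomputable def hypLoss (h : X → Y) (zs : List (X × S)) : ℝ :=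
  (zs.map fun z => setLoss (h z.1) (z.2 : Set Y)).sum

theorem hypLoss_cons (h : X → Y) (z : X × S) (zs : List (X × S)) :
    hypLoss h (z :: zs) = setLoss (h z.1) (z.2 : Set Y) + hypLoss h zs := by
  simp [hypLoss]

theorem hypLoss_append (h : X → Y) (zs ws : List (X × S)) :
    hypLoss h (zs ++ ws) = hypLoss h zs + hypLoss h ws := by
  simp [hypLoss]

theorem hypLoss_nonneg (h : X → Y) (zs : List (X × S)) : 0 ≤ hypLoss h zs := by
  induction zs with
  | nil => exact le_rfl
  | cons z zs ih => rw [hypLoss_cons]; exact add_nonneg (setLoss_nonneg _ _) ih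

theorem sum_setLoss_eq_hypLoss (h : X → Y) {T : ℕ} (z : Fin T → X × S) :
    ∑ t, setLoss (h (z t).1) ((z t).2 : Set Y) = hypLoss h (List.ofFn z) := by
  rw [hypLoss, List.map_ofFn, List.sum_ofFn]
  rfl

theorem bestLoss_le {H : Set (X → Y)} {h : X → Y} (hh : h ∈ H) {T : ℕ} (z : Fin T → X × S) :
    bestLoss H z ≤ hypLoss h (List.ofFn z) := by
  rw [← sum_setLoss_eq_hypLoss]
  refine ciInf_le (f := fun h : H => ∑ t, setLoss (h.1 (z t).1) ((z t).2 : Set Y))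
    ⟨0, ?_⟩ ⟨h, hh⟩
  rintro _ ⟨g, rfl⟩
  exact Finset.sum_nonneg fun t _ => setLoss_nonneg _ _

theorem le_bestLoss {H : Set (X → Y)} (hH : H.Nonempty) {T : ℕ} (z : Fin T → X × S) {c : ℝ}
    (hc : ∀ h ∈ H, c ≤ hypLoss h (List.ofFn z)) : c ≤ bestLoss H z := by
  have : Nonempty H := hH.to_subtype
  refine le_ciInf fun h => ?_
  rw [sum_setLoss_eq_hypLoss]
  exact hc h.1 h.2

theorem exists_ofFn_eq {α : Type*} {T : ℕ} {zs : List α} (h : zs.length = T) :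
    ∃ z : Fin T → α, List.ofFn z = zs := by
  subst h
  exact ⟨zs.get, List.ofFn_get zs⟩

theorem realizable_iff {H : Set (X → Y)} {T : ℕ} (z : Fin T → X × S) :
    Realizable H z ↔ ∃ h ∈ H, ∀ w ∈ List.ofFn z, h w.1 ∈ (w.2 : Set Y) := by
  simp only [Realizable, List.mem_ofFn]
  constructor
  · rintro ⟨h, hh, hz⟩
    exact ⟨h, hh, by rintro _ ⟨t, rfl⟩; exact hz t⟩
  · rintro ⟨h, hh, hz⟩
    exact ⟨h, hh, fun t => hz _ ⟨t, rfl⟩⟩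

end HypothesisLoss

/-! ### Expected losses of learners along a stream -/

section Loss

variable {X Y : Type*} [Fintype Y] {S : Set (Set Y)}

/-- The expected loss of a random prediction with law `p`. -/
noncomputable def roundLoss (p : PMF Y) (B : Set Y) : ℝ :=
  ∑ y, (p y).toReal * setLoss y B

theorem sum_toReal_pmf {ι : Type*} [Fintype ι] (p : PMF ι) : ∑ y, (p y).toReal = 1 := by
  rw [← ENNReal.toReal_sum fun y _ => p.apply_ne_top y, ← tsum_fintype (L := .unconditional _),
    p.tsum_coe, ENNReal.toReal_one]

theorem roundLoss_nonneg (p : PMF Y) (B : Set Y) : 0 ≤ roundLoss p B :=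
  Finset.sum_nonneg fun y _ => mul_nonneg ENNReal.toReal_nonneg (setLoss_nonneg y B)

theorem roundLoss_le_one (p : PMF Y) (B : Set Y) : roundLoss p B ≤ 1 := by
  rw [← sum_toReal_pmf p]
  exact Finset.sum_le_sum fun y _ =>
    mul_le_of_le_one_right ENNReal.toReal_nonneg (setLoss_le_one y B)

theorem roundLoss_pure (y : Y) (B : Set Y) : roundLoss (PMF.pure y) B = setLoss y B := by
  classical
  rw [roundLoss, Finset.sum_eq_single y]
  · simp
  · intro b _ hb
    simp [PMF.pure_apply, hb]
  · simp

/-- No label lies in both of two disjoint sets, so every prediction errs on at least one of them. -/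
theorem one_le_roundLoss_add (p : PMF Y) {B C : Set Y} (h : Disjoint B C) :
    1 ≤ roundLoss p B + roundLoss p C := by
  rw [roundLoss, roundLoss, ← Finset.sum_add_distrib, ← sum_toReal_pmf p]
  refine Finset.sum_le_sum fun y _ => ?_
  rw [← mul_add]
  refine le_mul_of_one_le_right ENNReal.toReal_nonneg ?_
  by_cases hB : y ∈ B
  · rw [setLoss_of_notMem (Set.disjoint_left.1 h hB)]
    linarith [setLoss_nonneg y B]
  · rw [setLoss_of_notMem hB]
    linarith [setLoss_nonneg y C]

/-- The expected number of mistakes of `A` on the examples `zs` that follow the history `hist`. -/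
noncomputable def cumLoss (A : RandomizedLearner X Y S) : List (X × S) → List (X × S) → ℝ
  | _, [] => 0
  | hist, z :: zs => roundLoss (A hist z.1) z.2 + cumLoss A (hist ++ [z]) zs

theorem cumLoss_nonneg (A : RandomizedLearner X Y S) (hist zs : List (X × S)) :
    0 ≤ cumLoss A hist zs := by
  induction zs generalizing hist with
  | nil => exact le_rfl
  | cons z zs ih => exact add_nonneg (roundLoss_nonneg _ _) (ih _)

theorem cumLoss_le_length (A : RandomizedLearner X Y S) (hist zs : List (X × S)) :
    cumLoss A hist zs ≤ zs.length := by
  induction zs generalizing hist with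
  | nil => simp [cumLoss]
  | cons z zs ih =>
    simp only [cumLoss, List.length_cons, Nat.cast_succ]
    linarith [roundLoss_le_one (A hist z.1) z.2, ih (hist ++ [z])]

theorem cumLoss_append (A : RandomizedLearner X Y S) (hist zs ws : List (X × S)) :
    cumLoss A hist (zs ++ ws) = cumLoss A hist zs + cumLoss A (hist ++ zs) ws := by
  induction zs generalizing hist with
  | nil => simp [cumLoss]
  | cons z zs ih =>
    simp only [cumLoss, List.cons_append, ih]
    simp [add_assoc]

theorem sum_roundLoss_eq_cumLoss (A : RandomizedLearner X Y S) {T : ℕ} (z : Fin T → X × S)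
    (hist : List (X × S)) :
    ∑ t : Fin T, roundLoss (A (hist ++ (List.ofFn z).take t) (z t).1) (z t).2
      = cumLoss A hist (List.ofFn z) := by
  induction T generalizing hist with
  | zero => simp [cumLoss]
  | succ T ih =>
    rw [Fin.sum_univ_succ, List.ofFn_succ, cumLoss, ← ih]
    simp

theorem expectedLoss_eq_cumLoss (A : RandomizedLearner X Y S) {T : ℕ} (z : Fin T → X × S) :
    expectedLoss A z = cumLoss A [] (List.ofFn z) := by
  rw [← sum_roundLoss_eq_cumLoss]
  rfl

theorem le_mistakes (A : RandomizedLearner X Y S) {H : Set (X → Y)} {h : X → Y} (hh : h ∈ H)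
    {zs : List (X × S)} {T : ℕ} (hT : zs.length = T) (hz : ∀ w ∈ zs, h w.1 ∈ (w.2 : Set Y))
    {c : ℝ} (hc : c ≤ cumLoss A [] zs) : (c : EReal) ≤ mistakes A T H := by
  obtain ⟨z, rfl⟩ := exists_ofFn_eq hT
  refine le_iSup₂_of_le z ((realizable_iff z).2 ⟨h, hh, hz⟩) ?_
  rw [expectedLoss_eq_cumLoss]
  exact_mod_cast hc

theorem le_regret (A : RandomizedLearner X Y S) {H : Set (X → Y)} {h : X → Y} (hh : h ∈ H)
    {zs : List (X × S)} {T : ℕ} (hT : zs.length = T)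
    {c : ℝ} (hc : c ≤ cumLoss A [] zs - hypLoss h zs) : (c : EReal) ≤ regret A T H := by
  obtain ⟨z, rfl⟩ := exists_ofFn_eq hT
  refine le_iSup_of_le z ?_
  rw [expectedLoss_eq_cumLoss]
  have := bestLoss_le hh z
  exact_mod_cast (by linarith : c ≤ cumLoss A [] (List.ofFn z) - bestLoss H z)

theorem mistakes_le (A : RandomizedLearner X Y S) {H : Set (X → Y)} {T : ℕ} {c : ℝ}
    (hc : ∀ zs : List (X × S), zs.length = T → ∀ h ∈ H, (∀ w ∈ zs, h w.1 ∈ (w.2 : Set Y)) →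
      cumLoss A [] zs ≤ c) : mistakes A T H ≤ (c : EReal) := by
  refine iSup₂_le fun z hz => ?_
  obtain ⟨h, hh, hw⟩ := (realizable_iff z).1 hz
  rw [expectedLoss_eq_cumLoss]
  exact_mod_cast hc _ (by simp) h hh hw

theorem regret_le (A : RandomizedLearner X Y S) {H : Set (X → Y)} (hH : H.Nonempty) {T : ℕ} {c : ℝ}
    (hc : ∀ zs : List (X × S), zs.length = T → ∀ h ∈ H,
      cumLoss A [] zs ≤ c + hypLoss h zs) : regret A T H ≤ (c : EReal) := by
  refine iSup_le fun z => ?_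
  have := le_bestLoss hH z (c := cumLoss A [] (List.ofFn z) - c) fun h hh => by
    linarith [hc (List.ofFn z) (by simp) h hh]
  rw [expectedLoss_eq_cumLoss]
  exact_mod_cast (by linarith : cumLoss A [] (List.ofFn z) - bestLoss H z ≤ c)

end Loss

/-! ### Khinchine's inequality for sign sums and the choice of block sizes -/

section SignPotential

/-- The expectation of `|s + ε₁ + ⋯ + εᵣ|` for independent uniform signs `εᵢ`. -/
noncomputable def signPotential : ℕ → ℤ → ℝ
  | 0, s => |(s : ℝ)|
  | r + 1, s => (signPotential r (s + 1) + signPotential r (s - 1)) / 2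

theorem signPotential_le_succ (r : ℕ) (s : ℤ) : signPotential r s ≤ signPotential (r + 1) s := by
  induction r generalizing s with
  | zero =>
    simp only [signPotential]
    push_cast
    have := abs_add_le ((s : ℝ) + 1) (s - 1)
    have h2 : ((s : ℝ) + 1) + (s - 1) = 2 * s := by ring
    rw [h2, abs_mul, abs_two] at this
    linarith
  | succ r ih =>
    rw [signPotential, signPotential]
    linarith [ih (s + 1), ih (s - 1)]

/-- Averaging `|x + ε|` over a sign adds to `|x|` exactly when the integer `x` is `0`, and then it
adds `1`. The increment is therefore the probability that the walk started at `2j - r` is at `0`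
after `r` steps, which needs `j` minus signs. -/
theorem choose_le_signPotential_sub (r j : ℕ) :
    (r.choose j : ℝ) / 2 ^ r
      ≤ signPotential (r + 1) (2 * j - r) - signPotential r (2 * j - r) := by
  induction r generalizing j with
  | zero =>
    cases j with
    | zero => simp [signPotential]
    | succ j => simpa using signPotential_le_succ 0 _
  | succ r ih =>
    have hrec : ∀ s : ℤ, signPotential (r + 1 + 1) s - signPotential (r + 1) s
        = ((signPotential (r + 1) (s + 1) - signPotential r (s + 1))
          + (signPotential (r + 1) (s - 1) - signPotential r (s - 1))) / 2 := by
      intro s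
      simp only [signPotential]
      ring
    rw [hrec]
    have e1 : (2 * (j : ℤ) - ((r + 1 : ℕ) : ℤ)) + 1 = 2 * j - r := by push_cast; ring
    rw [e1]
    have h1 := ih j
    cases j with
    | zero =>
      have h2 := signPotential_le_succ r (2 * ((0 : ℕ) : ℤ) - ((r + 1 : ℕ) : ℤ) - 1)
      simp only [Nat.choose_zero_right, Nat.cast_one] at h1 ⊢
      rw [pow_succ, ← div_div, div_le_div_iff_of_pos_right two_pos]
      exact h1.trans (le_add_of_nonneg_right (sub_nonneg.2 h2))
    | succ j =>
      have e2 : (2 * ((j + 1 : ℕ) : ℤ) - ((r + 1 : ℕ) : ℤ)) - 1 = 2 * j - r := by push_cast; ring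
      rw [e2, Nat.choose_succ_succ, pow_succ, ← div_div]
      have h2 := ih j
      push_cast at h1 h2 ⊢
      rw [add_div]
      linarith

/-- The bound `C(2m, m) ≥ 4^m / (2√m)`, by induction from the recursion of central binomials and
`4m(m+1) ≤ (2m+1)²`. -/
theorem sixteen_pow_le_mul_centralBinom_sq (n : ℕ) :
    16 ^ (n + 1) ≤ 4 * (n + 1) * (n + 1).centralBinom ^ 2 := by
  induction n with
  | zero => simp [Nat.centralBinom, Nat.choose]
  | succ n ih =>
    have h := Nat.succ_mul_centralBinom_succ (n + 1)
    refine Nat.le_of_mul_le_mul_left ?_ (Nat.succ_pos (n + 1))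
    calc (n + 1 + 1) * 16 ^ (n + 1 + 1) = 16 * (n + 2) * 16 ^ (n + 1) := by ring
      _ ≤ 16 * (n + 2) * (4 * (n + 1) * (n + 1).centralBinom ^ 2) := Nat.mul_le_mul_left _ ih
      _ = 16 * (4 * (n + 1) * (n + 2)) * (n + 1).centralBinom ^ 2 := by ring
      _ ≤ 16 * (2 * (n + 1) + 1) ^ 2 * (n + 1).centralBinom ^ 2 := by
        gcongr
        nlinarith
      _ = 4 * (2 * (2 * (n + 1) + 1) * (n + 1).centralBinom) ^ 2 := by ring
      _ = 4 * ((n + 1 + 1) * (n + 1 + 1).centralBinom) ^ 2 := by rw [h]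
      _ = (n + 1 + 1) * (4 * (n + 1 + 1) * (n + 1 + 1).centralBinom ^ 2) := by ring

/-- Both sides compare with `1 / (2√m)`, which bounds `√(m+1) - √m` above and the return probability
below. -/
theorem sqrt_succ_sub_sqrt_le_centralBinom (m : ℕ) :
    √((m : ℝ) + 1) ≤ √m + (m.centralBinom : ℝ) / 4 ^ m := by
  cases m with
  | zero => simp
  | succ n =>
    set c : ℝ := ((n + 1).centralBinom : ℝ) / 4 ^ (n + 1) with hc
    have hc0 : 0 ≤ c := by positivity
    have h16 : (16 : ℝ) ^ (n + 1) ≤ 4 * (n + 1) * ((n + 1).centralBinom : ℝ) ^ 2 := by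
      exact_mod_cast sixteen_pow_le_mul_centralBinom_sq n
    have hsq : 1 ≤ 4 * ((n + 1 : ℕ) : ℝ) * c ^ 2 := by
      rw [hc, div_pow, ← pow_mul, mul_comm (n + 1) 2, pow_mul, ← mul_div_assoc,
        one_le_div (by positivity)]
      norm_num
      exact_mod_cast h16
    set a : ℝ := √((n + 1 : ℕ) : ℝ)
    have ha0 : 0 ≤ a := Real.sqrt_nonneg _
    have ha : a ^ 2 = ((n + 1 : ℕ) : ℝ) := Real.sq_sqrt (by positivity)
    have hac : 1 ≤ 2 * (a * c) := by
      rw [← ha] at hsq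
      have : (1 : ℝ) ^ 2 ≤ (2 * (a * c)) ^ 2 := by nlinarith
      exact le_of_sq_le_sq this (by positivity)
    refine Real.sqrt_le_iff.2 ⟨by positivity, ?_⟩
    nlinarith [sq_nonneg c]

/-- The walk can be at `0` only at even times, so the potential grows in the steps from `2m` to `2m
+ 1`, and the gains dominate the increments of the square root. -/
theorem sqrt_le_signPotential (m : ℕ) :
    √(m : ℝ) ≤ signPotential (2 * m) 0 ∧ √((m : ℝ) + 1) ≤ signPotential (2 * m + 1) 0 := by
  have step : ∀ k : ℕ, √(k : ℝ) ≤ signPotential (2 * k) 0 →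
      √((k : ℝ) + 1) ≤ signPotential (2 * k + 1) 0 := by
    intro k hk
    have h := choose_le_signPotential_sub (2 * k) k
    have e : (2 * (k : ℤ) - ((2 * k : ℕ) : ℤ)) = 0 := by push_cast; ring
    rw [e, pow_mul] at h
    have h2 := sqrt_succ_sub_sqrt_le_centralBinom k
    rw [Nat.centralBinom] at h2
    norm_num at h h2
    linarith
  induction m with
  | zero => exact ⟨by simp [signPotential], step 0 (by simp [signPotential])⟩
  | succ m ih =>
    have : √((m + 1 : ℕ) : ℝ) ≤ signPotential (2 * (m + 1)) 0 := by
      push_cast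
      exact ih.2.trans (signPotential_le_succ (2 * m + 1) 0)
    exact ⟨this, step _ this⟩

/-- `T` rounds can be split into `d` blocks so that the expected absolute values of the block sums of
`T` signs add up to at least `√(dT/2)`, even if `d` does not divide `T`. -/
theorem exists_block_sizes {d T : ℕ} (hd : 1 ≤ d) (hT : d ≤ T) :
    ∃ ks : List ℕ, ks.length = d ∧ ks.sum = T ∧
      √((d : ℝ) * T / 2) ≤ (ks.map fun k => signPotential k 0).sum := by
  -- Odd blocks are favourable: size `2q + 1` yields `√(q + 1)`, more than the required `√(k/2)`.
  -- Thus `j` blocks receive two extra rounds, and a single other block absorbs the parity bit `e`.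
  obtain ⟨q, j, e, hj, he, hTe⟩ : ∃ q j e : ℕ, j < d ∧ e ≤ 1 ∧ T = d * (2 * q + 1) + 2 * j + e := by
    refine ⟨(T - d) / (2 * d), (T - d) % (2 * d) / 2, (T - d) % (2 * d) % 2, ?_, ?_, ?_⟩
    · have := Nat.mod_lt (T - d) (show 0 < 2 * d by omega)
      omega
    · omega
    · have h1 := Nat.div_add_mod (T - d) (2 * d)
      have h2 := Nat.div_add_mod ((T - d) % (2 * d)) 2
      have h3 : d * (2 * ((T - d) / (2 * d)) + 1) = 2 * d * ((T - d) / (2 * d)) + d := by ring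
      omega
  obtain ⟨l, rfl⟩ : ∃ l, d = j + (l + 1) := ⟨d - j - 1, by omega⟩
  refine ⟨List.replicate j (2 * (q + 1) + 1) ++ (2 * q + 1 + e) :: List.replicate l (2 * q + 1),
    by simp, ?_, ?_⟩
  · simp only [List.sum_append, List.sum_replicate, List.sum_cons, smul_eq_mul]
    rw [hTe]; ring
  · have h1 : √((q : ℝ) + 1) ≤ signPotential (2 * q + 1) 0 := (sqrt_le_signPotential q).2
    have h2 : √((q : ℝ) + 2) ≤ signPotential (2 * (q + 1) + 1) 0 := by
      have := (sqrt_le_signPotential (q + 1)).2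
      push_cast at this
      rwa [add_assoc, one_add_one_eq_two] at this
    have h3 : √((q : ℝ) + 1) ≤ signPotential (2 * q + 1 + e) 0 := by
      obtain rfl | rfl : e = 0 ∨ e = 1 := by omega
      · exact h1
      · exact h1.trans (signPotential_le_succ _ _)
    simp only [List.map_append, List.map_replicate, List.map_cons, List.sum_append,
      List.sum_replicate, List.sum_cons, nsmul_eq_mul]
    have hsum : (j : ℝ) * √((q : ℝ) + 2) + (l + 1) * √((q : ℝ) + 1) ≤
        j * signPotential (2 * (q + 1) + 1) 0
          + (signPotential (2 * q + 1 + e) 0 + l * signPotential (2 * q + 1) 0) := by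
      have := mul_le_mul_of_nonneg_left h2 (Nat.cast_nonneg (α := ℝ) j)
      have := mul_le_mul_of_nonneg_left h1 (Nat.cast_nonneg (α := ℝ) l)
      linarith
    refine le_trans ?_ hsum
    set a := √((q : ℝ) + 1)
    set b := √((q : ℝ) + 2)
    have ha0 : 0 ≤ a := Real.sqrt_nonneg _
    have hab : a ≤ b := Real.sqrt_le_sqrt (by linarith)
    have ha : a ^ 2 = q + 1 := Real.sq_sqrt (by positivity)
    have hb : b ^ 2 = q + 2 := Real.sq_sqrt (by positivity)
    refine Real.sqrt_le_iff.2 ⟨by positivity, ?_⟩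
    have hcross : (j : ℝ) * (l + 1) * (q + 1) ≤ j * (l + 1) * (a * b) := by
      refine mul_le_mul_of_nonneg_left ?_ (by positivity)
      nlinarith
    have hsq : ((j : ℝ) * b + (l + 1) * a) ^ 2
        = j ^ 2 * (q + 2) + (l + 1) ^ 2 * (q + 1) + 2 * (j * (l + 1) * (a * b)) := by
      rw [← ha, ← hb]; ring
    -- With `a * b ≥ q + 1`, the desired inequality reduces to exactly this one.
    have hint : ((j : ℝ) + (l + 1)) * e ≤ j ^ 2 + (l + 1) ^ 2 := by
      have : (j + (l + 1)) * e ≤ j ^ 2 + (l + 1) ^ 2 := by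
        calc (j + (l + 1)) * e ≤ (j + (l + 1)) * 1 := Nat.mul_le_mul_left _ he
          _ ≤ j ^ 2 + (l + 1) ^ 2 := by nlinarith [Nat.le_self_pow two_ne_zero j]
      exact_mod_cast this
    rw [hsq, hTe]
    push_cast
    nlinarith

end SignPotential

/-! ### Hypotheses on a block of repeated instances -/

section Blocks

variable {X Y : Type*} {S : Set (Set Y)}

/-- The number of `0`s minus the number of `1`s in a binary word. -/
def excess (ws : List (Fin 2)) : ℤ :=
  (ws.map fun i => if i = 0 then 1 else -1).sum

/-- A hypothesis correct on one branch can err only on letters of the other branch, and `excess`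
counts these. -/
theorem hypLoss_block_le (h : X → Y) (x : X) (B : Fin 2 → S) (ws : List (Fin 2)) :
    (h x ∈ (B 0 : Set Y) →
      2 * hypLoss h (ws.map fun i => (x, B i)) ≤ ws.length - (excess ws : ℝ)) ∧
    (h x ∈ (B 1 : Set Y) →
      2 * hypLoss h (ws.map fun i => (x, B i)) ≤ ws.length + (excess ws : ℝ)) := by
  induction ws with
  | nil => simp [hypLoss, excess]
  | cons i ws ih =>
    have hex : (excess (i :: ws) : ℝ) = (if i = 0 then 1 else -1) + (excess ws : ℝ) := by
      simp [excess]
    rw [hex]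
    simp only [List.map_cons, hypLoss_cons, List.length_cons]
    push_cast
    refine ⟨fun hx => ?_, fun hx => ?_⟩
    · have := ih.1 hx
      fin_cases i
      · simp [setLoss_of_mem hx]; linarith
      · have := setLoss_le_one (h x) (B 1 : Set Y)
        simp; linarith
    · have := ih.2 hx
      fin_cases i
      · have := setLoss_le_one (h x) (B 0 : Set Y)
        simp; linarith
      · simp [setLoss_of_mem hx]; linarith

theorem exists_majority (x : X) (B : Fin 2 → S) (ws : List (Fin 2)) :
    ∃ i, ∀ h : X → Y, h x ∈ (B i : Set Y) →
      2 * hypLoss h (ws.map fun i => (x, B i)) ≤ ws.length - |(excess ws : ℝ)| := by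
  rcases le_total 0 (excess ws : ℝ) with hs | hs
  · exact ⟨0, fun h hx => by rw [abs_of_nonneg hs]; exact (hypLoss_block_le h x B ws).1 hx⟩
  · refine ⟨1, fun h hx => ?_⟩
    rw [abs_of_nonpos hs, sub_neg_eq_add]
    exact (hypLoss_block_le h x B ws).2 hx

theorem hypLoss_replicate_univ (huniv : Set.univ ∈ S) (h : X → Y) (x : X) (n : ℕ) :
    hypLoss h (List.replicate n (x, (⟨Set.univ, huniv⟩ : S))) = 0 := by
  simp [hypLoss, setLoss]

end Blocks

/-! ### Adversarial streams from shattered trees -/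

section LowerBounds

variable {X Y : Type*} [Fintype Y] {S : Set (Set Y)}

theorem exists_half_le_roundLoss (p : PMF Y) {B : Fin 2 → Set Y} (h : Disjoint (B 0) (B 1)) :
    ∃ i, 1 / 2 ≤ roundLoss p (B i) := by
  by_contra! hn
  linarith [one_le_roundLoss_add p h, hn 0, hn 1]

theorem exists_realizable_stream {d : ℕ} {V : Set (X → Y)} (hs : ShatterDepth S d V)
    (A : RandomizedLearner X Y S) (hist : List (X × S)) :
    ∃ zs : List (X × S), zs.length = d ∧ (∃ h ∈ V, ∀ w ∈ zs, h w.1 ∈ (w.2 : Set Y)) ∧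
      (d : ℝ) / 2 ≤ cumLoss A hist zs := by
  induction d generalizing V hist with
  | zero =>
    obtain ⟨h, hh⟩ := hs
    exact ⟨[], rfl, ⟨h, hh, by simp⟩, by simp [cumLoss]⟩
  | succ d ih =>
    obtain ⟨x, B, hB, hdisj, hch⟩ := hs
    obtain ⟨i, hi⟩ := exists_half_le_roundLoss (A hist x) hdisj
    obtain ⟨zs, hl, ⟨h, hh, hz⟩, hc⟩ := ih (hch i) (hist ++ [(x, ⟨B i, hB i⟩)])
    refine ⟨(x, ⟨B i, hB i⟩) :: zs, by simp [hl], ⟨h, hh.1, ?_⟩, ?_⟩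
    · simp only [List.mem_cons, forall_eq_or_imp]
      exact ⟨hh.2, hz⟩
    · simp only [cumLoss]
      push_cast
      linarith

/-- The inequality holds on average over uniform signs, as each round costs the learner at least
`1/2` on average. The induction keeps a letter that does at least as well as the average; the offset
`s` records the signs already played. -/
theorem exists_block (A : RandomizedLearner X Y S) (x : X) (B : Fin 2 → S)
    (hdisj : Disjoint (B 0 : Set Y) (B 1)) (r : ℕ) (s : ℤ) (hist : List (X × S)) :
    ∃ ws : List (Fin 2), ws.length = r ∧
      r + signPotential r s - |((s + excess ws : ℤ) : ℝ)|
        ≤ 2 * cumLoss A hist (ws.map fun i => (x, B i)) := by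
  induction r generalizing s hist with
  | zero => exact ⟨[], rfl, by simp [signPotential, excess, cumLoss]⟩
  | succ r ih =>
    obtain ⟨u, hu, hcu⟩ := ih (s + 1) (hist ++ [(x, B 0)])
    obtain ⟨v, hv, hcv⟩ := ih (s - 1) (hist ++ [(x, B 1)])
    have hone := one_le_roundLoss_add (A hist x) hdisj
    have e0 : s + excess (0 :: u) = s + 1 + excess u := by simp [excess]; ring
    have e1 : s + excess (1 :: v) = s - 1 + excess v := by simp [excess]; ring
    by_contra! hn
    have h0 := hn (0 :: u) (by simp [hu])
    have h1 := hn (1 :: v) (by simp [hv])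
    rw [e0] at h0
    rw [e1] at h1
    simp only [List.map_cons, cumLoss, signPotential] at h0 h1
    push_cast at h0 h1 hcu hcv
    linarith

/-- After each block the construction descends to the child of the majority letter, whose subtree is
shattered by hypotheses that save half of `|excess|` on that block. -/
theorem exists_stream_of_blocks (A : RandomizedLearner X Y S) {ks : List ℕ} {V : Set (X → Y)}
    (hs : ShatterDepth S ks.length V) (hist : List (X × S)) :
    ∃ zs : List (X × S), zs.length = ks.sum ∧ ∃ h ∈ V,
      (ks.map fun k => signPotential k 0).sum / 2 ≤ cumLoss A hist zs - hypLoss h zs := by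
  induction ks generalizing V hist with
  | nil =>
    obtain ⟨h, hh⟩ := hs
    exact ⟨[], rfl, h, hh, by simp [cumLoss, hypLoss]⟩
  | cons k ks ih =>
    obtain ⟨x, B, hB, hdisj, hch⟩ := hs
    obtain ⟨ws, hl, hc⟩ := exists_block A x (fun i => (⟨B i, hB i⟩ : S)) hdisj k 0 hist
    obtain ⟨i, hi⟩ := exists_majority x (fun i => (⟨B i, hB i⟩ : S)) ws
    set bs : List (X × S) := ws.map fun i => (x, ⟨B i, hB i⟩) with hbs
    obtain ⟨zs, hzl, h, hh, hz⟩ := ih (hch i) (hist ++ bs)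
    refine ⟨bs ++ zs, by simp [hbs, hl, hzl], h, hh.1, ?_⟩
    have hb := hi h hh.2
    rw [cumLoss_append, hypLoss_append]
    simp only [List.map_cons, List.sum_cons]
    rw [hl] at hb
    rw [zero_add] at hc
    linarith

theorem half_le_mistakes [Nonempty X] (huniv : Set.univ ∈ S) {d T : ℕ} {H : Set (X → Y)}
    (hs : ShatterDepth S d H) (hT : d ≤ T) (A : RandomizedLearner X Y S) :
    (((d : ℝ) / 2 : ℝ) : EReal) ≤ mistakes A T H := by
  obtain ⟨zs, hl, ⟨h, hh, hz⟩, hc⟩ := exists_realizable_stream hs A []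
  -- The remaining rounds reveal the full set, on which nobody errs.
  refine le_mistakes A hh
    (zs := zs ++ List.replicate (T - d) (Classical.arbitrary X, ⟨Set.univ, huniv⟩))
    (by simp [hl, hT]) ?_ ?_
  · intro w hw
    rcases List.mem_append.1 hw with hw | hw
    · exact hz w hw
    · rw [(List.mem_replicate.1 hw).2]
      exact Set.mem_univ _
  · rw [cumLoss_append]
    linarith [cumLoss_nonneg A ([] ++ zs)
      (List.replicate (T - d) (Classical.arbitrary X, ⟨Set.univ, huniv⟩))]

theorem sqrt_le_regret [Nonempty X] (huniv : Set.univ ∈ S) {d T : ℕ} {H : Set (X → Y)}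
    (hs : ShatterDepth S d H) (hT : d ≤ T) (A : RandomizedLearner X Y S) :
    ((√((d : ℝ) * T / 8) : ℝ) : EReal) ≤ regret A T H := by
  rcases Nat.eq_zero_or_pos d with rfl | hd
  · obtain ⟨h, hh⟩ := hs
    refine le_regret A hh
      (zs := List.replicate T (Classical.arbitrary X, ⟨Set.univ, huniv⟩)) (by simp) ?_
    rw [hypLoss_replicate_univ]
    simpa using cumLoss_nonneg A [] _
  · obtain ⟨ks, hlen, hsum, hks⟩ := exists_block_sizes hd hT
    obtain ⟨zs, hl, h, hh, hz⟩ := exists_stream_of_blocks A (ks := ks) (hlen ▸ hs) []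
    refine le_regret A hh (hl.trans hsum) (le_trans ?_ hz)
    have e : (d : ℝ) * T / 8 = (d : ℝ) * T / 2 / 2 ^ 2 := by ring
    rw [e, Real.sqrt_div' _ (by positivity), Real.sqrt_sq (by positivity)]
    linarith

end LowerBounds

/-! ### The standard optimal algorithm and its version spaces -/

section VersionSpace

variable {X Y : Type*} {S : Set (Set Y)}

/-- The prediction at `x` of the standard optimal algorithm with version space `V`: a label lying in
every set whose revelation would not decrease the dimension of `V`, if there is one. -/
noncomputable def soa [Nonempty Y] (S : Set (Set Y)) (V : Set (X → Y)) (x : X) : Y :=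
  Classical.epsilon fun y => ∀ d, ShatterDepth S d V → ¬ ShatterDepth S (d + 1) V →
    ∀ B ∈ S, ShatterDepth S d (refine V x B) → y ∈ B

/-- Pairwise intersecting subfamilies of `S` have a common point. -/
def HasHellyTwo (S : Set (Set Y)) : Prop :=
  ∀ F ⊆ S, (∀ B ∈ F, ∀ C ∈ F, (B ∩ C).Nonempty) → (⋂₀ F).Nonempty

/-- Two disjoint sets that both preserve depth `d` would be the root edges of a shattered tree of
depth `d + 1`. Hence such sets pairwise intersect, and the Helly property supplies the label. -/
theorem mem_of_soa [Nonempty Y] (hS : HasHellyTwo S) {V : Set (X → Y)} {x : X} {d : ℕ}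
    (hd : ShatterDepth S d V) (hd' : ¬ ShatterDepth S (d + 1) V) {B : Set Y} (hB : B ∈ S)
    (hV : ShatterDepth S d (refine V x B)) : soa S V x ∈ B := by
  have key : ∃ y, ∀ d, ShatterDepth S d V → ¬ ShatterDepth S (d + 1) V →
      ∀ B ∈ S, ShatterDepth S d (refine V x B) → y ∈ B := by
    obtain ⟨y, hy⟩ := hS {B | B ∈ S ∧ ShatterDepth S d (refine V x B)} (fun B h => h.1) (by
      rintro B ⟨hB, hVB⟩ C ⟨hC, hVC⟩
      by_contra hne
      refine hd' ⟨x, ![B, C], ?_, ?_, ?_⟩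
      · simp [Fin.forall_fin_two, hB, hC]
      · simpa [Set.disjoint_iff_inter_eq_empty] using Set.not_nonempty_iff_eq_empty.1 hne
      · simp [Fin.forall_fin_two, hVB, hVC])
    refine ⟨y, fun c hc hc' C hC hVC => hy C ⟨hC, ?_⟩⟩
    -- The dimension is unique because shattered depths are closed downwards.
    obtain rfl : c = d := by
      rcases lt_trichotomy c d with h | h | h
      · exact absurd (hd.anti h) hc'
      · exact h
      · exact absurd (hc.anti h) hd'
    exact hVC
  exact Classical.epsilon_spec key d hd hd' B hB hV

/-- If the standard optimal algorithm errs and the correct set is revealed, then the bound on the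
dimension of the version space decreases. -/
theorem exists_of_soa_notMem [Nonempty Y] (hS : HasHellyTwo S) {V : Set (X → Y)} {x : X} {d : ℕ}
    (hd : ¬ ShatterDepth S (d + 1) V) {B : Set Y} (hB : B ∈ S) {h : X → Y} (hh : h ∈ V)
    (hx : h x ∈ B) (herr : soa S V x ∉ B) :
    ∃ c, d = c + 1 ∧ ¬ ShatterDepth S (c + 1) (refine V x B) := by
  classical
  -- `d` is only an upper bound; `Nat.find hex` is the exact dimension of `V`.
  have hex : ∃ n, ¬ ShatterDepth S (n + 1) V := ⟨d, hd⟩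
  have hle : Nat.find hex ≤ d := Nat.find_min' hex hd
  have h1 : ¬ ShatterDepth S (Nat.find hex + 1) V := Nat.find_spec hex
  have h0 : ShatterDepth S (Nat.find hex) V := by
    rcases Nat.eq_zero_or_pos (Nat.find hex) with h | h
    · rw [h]; exact ⟨_, hh⟩
    · obtain ⟨n, hn⟩ := Nat.exists_eq_succ_of_ne_zero h.ne'
      rw [hn]
      exact not_not.1 (Nat.find_min hex (by omega : n < Nat.find hex))
  have h2 : ¬ ShatterDepth S (Nat.find hex) (refine V x B) := fun hr =>
    herr (mem_of_soa hS h0 h1 hB hr)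
  cases d with
  | zero =>
    rw [Nat.le_zero.1 hle] at h2
    exact absurd ⟨h, hh, hx⟩ h2
  | succ c => exact ⟨c, rfl, fun hr => h2 (hr.anti hle)⟩

open Classical in
/-- The version space after the history `hist.reverse`, the examples being used only in the rounds
of `L` (counted from `0`). -/
noncomputable def versionSpace (H : Set (X → Y)) (L : Set ℕ) : List (X × S) → Set (X → Y)
  | [] => H
  | z :: zs =>
    if zs.length ∈ L then refine (versionSpace H L zs) z.1 z.2 else versionSpace H L zs

theorem versionSpace_congr {H : Set (X → Y)} {L L' : Set ℕ} {zs : List (X × S)}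
    (h : ∀ t < zs.length, t ∈ L ↔ t ∈ L') : versionSpace H L zs = versionSpace H L' zs := by
  induction zs with
  | nil => rfl
  | cons z zs ih =>
    have hi := ih fun t ht => h t (by simp; omega)
    have hz := h zs.length (by simp)
    by_cases hL : zs.length ∈ L'
    · simp [versionSpace, hi, hz.2 hL, hL]
    · simp [versionSpace, hi, mt hz.1 hL, hL]

/-- The learner that predicts by the standard optimal algorithm and updates its version space only
in the rounds of `L`. -/
noncomputable def soaLearner [Nonempty Y] (S : Set (Set Y)) (H : Set (X → Y)) (L : Set ℕ) :
    RandomizedLearner X Y S :=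
  fun hist x => PMF.pure (soa S (versionSpace H L hist.reverse) x)

end VersionSpace

/-! ### Mistakes of the standard optimal algorithm -/

section MistakeBound

variable {X Y : Type*} [Fintype Y] [Nonempty Y] {S : Set (Set Y)}

theorem cumLoss_soaLearner_univ_le (hS : HasHellyTwo S) {H : Set (X → Y)} {h : X → Y}
    (zs hist : List (X × S)) (d : ℕ)
    (hd : ¬ ShatterDepth S (d + 1) (versionSpace H Set.univ hist.reverse))
    (hh : h ∈ versionSpace H Set.univ hist.reverse) (hz : ∀ w ∈ zs, h w.1 ∈ (w.2 : Set Y)) :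
    cumLoss (soaLearner S H Set.univ) hist zs ≤ d := by
  induction zs generalizing hist d with
  | nil => simp [cumLoss]
  | cons z zs ih =>
    have hv : versionSpace H Set.univ (hist ++ [z]).reverse
        = refine (versionSpace H Set.univ hist.reverse) z.1 z.2 := by simp [versionSpace]
    have hz0 := hz z (by simp)
    have hz1 : ∀ w ∈ zs, h w.1 ∈ (w.2 : Set Y) := fun w hw => hz w (by simp [hw])
    simp only [cumLoss, soaLearner, roundLoss_pure]
    by_cases herr : soa S (versionSpace H Set.univ hist.reverse) z.1 ∈ (z.2 : Set Y)
    · rw [setLoss_of_mem herr, zero_add]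
      refine ih _ d ?_ ?_ hz1
      · rw [hv]
        exact fun hr => hd (hr.mono fun g hg => hg.1)
      · rw [hv]; exact ⟨hh, hz0⟩
    · obtain ⟨c, rfl, hc⟩ := exists_of_soa_notMem hS hd z.2.2 hh hz0 herr
      rw [setLoss_of_notMem herr]
      have := ih (hist ++ [z]) c (by rwa [hv]) (by rw [hv]; exact ⟨hh, hz0⟩) hz1
      push_cast
      linarith

/-- The added rounds are those where `h` is correct and the algorithm errs. Updating there keeps `h`
in the version space and lowers the dimension bound, so at most `d` rounds are added; in every other
round `h` loses at least as much. -/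
theorem exists_soaLearner_le (hS : HasHellyTwo S) {H : Set (X → Y)} {h : X → Y}
    (zs hist : List (X × S)) (d : ℕ) (L : Finset ℕ) (hL : ∀ t ∈ L, t < hist.length)
    (hd : ¬ ShatterDepth S (d + 1) (versionSpace H L hist.reverse))
    (hh : h ∈ versionSpace H L hist.reverse) :
    ∃ L' : Finset ℕ, L ⊆ L' ∧ (∀ t ∈ L', t ∉ L → hist.length ≤ t ∧ t < hist.length + zs.length) ∧
      L'.card ≤ L.card + d ∧
      cumLoss (soaLearner S H L') hist zs ≤ d + hypLoss h zs := by
  induction zs generalizing hist d L with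
  | nil => exact ⟨L, subset_rfl, fun t h1 h2 => absurd h1 h2, by omega, by simp [cumLoss, hypLoss]⟩
  | cons z zs ih =>
    have hn : hist.length ∉ L := fun h0 => lt_irrefl _ (hL _ h0)
    -- Rounds chosen later do not affect the version space after `hist`, so the prediction is
    -- already fixed.
    have hext : ∀ L' : Finset ℕ, L ⊆ L' →
        (∀ t ∈ L', t ∉ L → hist.length ≤ t ∧ t < hist.length + (z :: zs).length) →
        versionSpace H L' hist.reverse = versionSpace H L hist.reverse := by
      intro L' hLL' hL'
      refine versionSpace_congr fun t ht => ⟨fun ht' => ?_, fun ht' => hLL' ht'⟩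
      by_contra htL
      have := (hL' t ht' htL).1
      rw [List.length_reverse] at ht
      omega
    by_cases hup : h z.1 ∈ (z.2 : Set Y) ∧
        soa S (versionSpace H L hist.reverse) z.1 ∉ (z.2 : Set Y)
    · obtain ⟨hz, herr⟩ := hup
      obtain ⟨c, rfl, hc⟩ := exists_of_soa_notMem hS hd z.2.2 hh hz herr
      have hv : versionSpace H (insert hist.length L : Finset ℕ) (hist ++ [z]).reverse
          = refine (versionSpace H L hist.reverse) z.1 z.2 := by
        simp only [List.reverse_append, List.reverse_singleton, List.singleton_append, versionSpace,
          List.length_reverse]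
        rw [if_pos (by simp), hext _ (Finset.subset_insert _ _)]
        intro t ht htL
        rcases Finset.mem_insert.1 ht with rfl | ht
        · simp
        · exact absurd ht htL
      obtain ⟨L', hLL', hL', hcard, hloss⟩ := ih (hist ++ [z]) c (insert hist.length L)
        (by
          intro t ht
          rcases Finset.mem_insert.1 ht with rfl | ht
          · simp
          · have := hL t ht
            simp; omega)
        (by rwa [hv]) (by rw [hv]; exact ⟨hh, hz⟩)
      have hLL'' : L ⊆ L' := (Finset.subset_insert _ _).trans hLL'
      have hL'' : ∀ t ∈ L', t ∉ L →
          hist.length ≤ t ∧ t < hist.length + (z :: zs).length := by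
        intro t ht htL
        by_cases h0 : t = hist.length
        · simp [h0]
        · have := hL' t ht (by simp [h0, htL])
          simp at this ⊢
          omega
      refine ⟨L', hLL'', hL'', ?_, ?_⟩
      · rw [Finset.card_insert_of_notMem hn] at hcard
        omega
      · rw [cumLoss, hypLoss_cons, soaLearner, roundLoss_pure, hext L' hLL'' hL'',
          setLoss_of_notMem herr, setLoss_of_mem hz]
        push_cast
        linarith
    · have hv : versionSpace H L (hist ++ [z]).reverse = versionSpace H L hist.reverse := by
        simp only [List.reverse_append, List.reverse_singleton, List.singleton_append, versionSpace,
          List.length_reverse]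
        rw [if_neg (by simpa using hn)]
      obtain ⟨L', hLL', hL', hcard, hloss⟩ := ih (hist ++ [z]) d L
        (fun t ht => by have := hL t ht; simp; omega) (by rwa [hv]) (by rwa [hv])
      have hL'' : ∀ t ∈ L', t ∉ L →
          hist.length ≤ t ∧ t < hist.length + (z :: zs).length := by
        intro t ht htL
        have := hL' t ht htL
        simp at this ⊢
        omega
      refine ⟨L', hLL', hL'', hcard, ?_⟩
      rw [cumLoss, hypLoss_cons, soaLearner, roundLoss_pure, hext L' hLL' hL'']
      have hle : setLoss (soa S (versionSpace H L hist.reverse) z.1) (z.2 : Set Y)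
          ≤ setLoss (h z.1) (z.2 : Set Y) := by
        by_cases hz : h z.1 ∈ (z.2 : Set Y)
        · rw [setLoss_of_mem (not_not.1 fun h0 => hup ⟨hz, h0⟩)]
          exact setLoss_nonneg _ _
        · rw [setLoss_of_notMem hz]
          exact setLoss_le_one _ _
      linarith

end MistakeBound

/-! ### Exponentially weighted averages -/

section Hedge

variable {X Y : Type*} [Fintype Y] {S : Set (Set Y)} {ι : Type*} [Fintype ι]

theorem roundLoss_bind (p : PMF ι) (f : ι → PMF Y) (B : Set Y) :
    roundLoss (p.bind f) B = ∑ i, (p i).toReal * roundLoss (f i) B := by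
  have h : ∀ y, (p.bind f y).toReal = ∑ i, (p i).toReal * (f i y).toReal := by
    intro y
    rw [PMF.bind_apply, tsum_fintype, ENNReal.toReal_sum
      fun i _ => ENNReal.mul_ne_top (p.apply_ne_top i) ((f i).apply_ne_top y)]
    simp
  simp only [roundLoss, h, Finset.sum_mul, Finset.mul_sum]
  rw [Finset.sum_comm]
  simp only [mul_assoc]

/-- The probability distribution proportional to `exp ∘ g`. -/
noncomputable def expWeights [Nonempty ι] (g : ι → ℝ) : PMF ι :=
  PMF.ofFintype (fun i => ENNReal.ofReal (Real.exp (g i) / ∑ j, Real.exp (g j))) (by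
    have hpos : 0 < ∑ j, Real.exp (g j) :=
      Finset.sum_pos (fun j _ => Real.exp_pos _) Finset.univ_nonempty
    rw [← ENNReal.ofReal_sum_of_nonneg fun i _ => by positivity, ← Finset.sum_div,
      div_self hpos.ne', ENNReal.ofReal_one])

theorem toReal_expWeights [Nonempty ι] (g : ι → ℝ) (i : ι) :
    (expWeights g i).toReal = Real.exp (g i) / ∑ j, Real.exp (g j) := by
  rw [expWeights, PMF.ofFintype_apply, ENNReal.toReal_ofReal]
  exact div_nonneg (Real.exp_pos _).le (Finset.sum_nonneg fun j _ => (Real.exp_pos _).le)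

/-- The exponentially weighted average of the learners `E i` with learning rate `η`. -/
noncomputable def hedge [Nonempty ι] (η : ℝ) (E : ι → RandomizedLearner X Y S) :
    RandomizedLearner X Y S :=
  fun hist x => (expWeights fun i => -η * cumLoss (E i) [] hist).bind fun i => E i hist x

theorem exp_mul_le_affine (a : ℝ) {p : ℝ} (h0 : 0 ≤ p) (h1 : p ≤ 1) :
    Real.exp (a * p) ≤ 1 - p + p * Real.exp a := by
  have := convexOn_exp.2 (Set.mem_univ 0) (Set.mem_univ a) (sub_nonneg.2 h1) h0 (by ring)
  simpa [mul_comm] using this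

/-- A weak Hoeffding lemma. Multiplying by `exp (η p) ≤ 1 - p + p exp η` gives a product of at most
`cosh (η/2) ^ 2`, because `p (1 - p) ≤ 1/4`. -/
theorem affine_exp_neg_le (η : ℝ) {p : ℝ} (h0 : 0 ≤ p) (h1 : p ≤ 1) :
    1 - p + p * Real.exp (-η) ≤ Real.exp (-η * p + η ^ 2 / 4) := by
  have hu := exp_mul_le_affine η h0 h1
  have hc : Real.cosh (η / 2) ^ 2 ≤ Real.exp (η ^ 2 / 4) := by
    have := pow_le_pow_left₀ (Real.cosh_pos _).le (Real.cosh_le_exp_half_sq (η / 2)) 2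
    rw [← Real.exp_nat_mul] at this
    have e : η ^ 2 / 4 = ((2 : ℕ) : ℝ) * ((η / 2) ^ 2 / 2) := by push_cast; ring
    rwa [e]
  have hcosh : Real.cosh (η / 2) ^ 2 = (2 + Real.exp η + Real.exp (-η)) / 4 := by
    have h2 := Real.cosh_two_mul (η / 2)
    have h3 := Real.cosh_sq (η / 2)
    rw [mul_div_cancel₀ _ two_ne_zero, Real.cosh_eq] at h2
    linarith
  have hprod : Real.exp η * Real.exp (-η) = 1 := by rw [← Real.exp_add]; simp
  have hsum : 2 ≤ Real.exp η + Real.exp (-η) := by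
    have := Real.one_le_cosh η
    rw [Real.cosh_eq] at this
    linarith
  have hneg : 0 ≤ 1 - p + p * Real.exp (-η) := by
    have := Real.exp_pos (-η)
    have := mul_nonneg h0 this.le
    linarith
  have hmain : (1 - p + p * Real.exp (-η)) * Real.exp (η * p) ≤ Real.exp (η ^ 2 / 4) := by
    calc _ ≤ (1 - p + p * Real.exp (-η)) * (1 - p + p * Real.exp η) :=
          mul_le_mul_of_nonneg_left hu hneg
      _ = 1 + p * (1 - p) * (Real.exp η + Real.exp (-η) - 2) := by
          linear_combination p ^ 2 * hprod
      _ ≤ 1 + 1 / 4 * (Real.exp η + Real.exp (-η) - 2) := by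
          have : p * (1 - p) ≤ 1 / 4 := by nlinarith [sq_nonneg (p - 1 / 2)]
          have := mul_le_mul_of_nonneg_right this (sub_nonneg.2 hsum)
          linarith
      _ ≤ _ := by rw [hcosh] at hc; linarith
  rw [neg_mul, add_comm (-(η * p)), Real.exp_add, Real.exp_neg (η * p), ← div_eq_mul_inv, le_div_iff₀ (Real.exp_pos _)]
  exact hmain

/-- The total weight is the potential: each round multiplies it by at most `1 - p + p exp (-η)`,
where `p` is the loss of the weighted average. -/
theorem sum_exp_hedge_le [Nonempty ι] (η : ℝ) (E : ι → RandomizedLearner X Y S)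
    (zs hist : List (X × S)) :
    ∑ i, Real.exp (-η * cumLoss (E i) [] (hist ++ zs)) ≤
      (∑ i, Real.exp (-η * cumLoss (E i) [] hist)) *
        Real.exp (-η * cumLoss (hedge η E) hist zs + η ^ 2 / 4 * zs.length) := by
  induction zs generalizing hist with
  | nil => simp [cumLoss]
  | cons z zs ih =>
    set W := ∑ i, Real.exp (-η * cumLoss (E i) [] hist) with hW
    have hWpos : 0 < W := Finset.sum_pos (fun j _ => Real.exp_pos _) Finset.univ_nonempty
    set p := roundLoss (hedge η E hist z.1) (z.2 : Set Y) with hp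
    have hpW : p * W = ∑ i, Real.exp (-η * cumLoss (E i) [] hist) *
        roundLoss (E i hist z.1) (z.2 : Set Y) := by
      rw [hp, hedge, roundLoss_bind, Finset.sum_mul]
      refine Finset.sum_congr rfl fun i _ => ?_
      rw [toReal_expWeights, ← hW]
      field_simp
    have hstep : ∑ i, Real.exp (-η * cumLoss (E i) [] (hist ++ [z]))
        ≤ W * Real.exp (-η * p + η ^ 2 / 4) := by
      calc ∑ i, Real.exp (-η * cumLoss (E i) [] (hist ++ [z]))
          ≤ ∑ i, Real.exp (-η * cumLoss (E i) [] hist) *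
            (1 - roundLoss (E i hist z.1) (z.2 : Set Y)
              + roundLoss (E i hist z.1) (z.2 : Set Y) * Real.exp (-η)) := by
            refine Finset.sum_le_sum fun i _ => ?_
            rw [cumLoss_append, mul_add, Real.exp_add]
            refine mul_le_mul_of_nonneg_left ?_ (Real.exp_pos _).le
            simpa [cumLoss] using
              exp_mul_le_affine (-η) (roundLoss_nonneg (E i hist z.1) z.2) (roundLoss_le_one _ _)
        _ = W - p * W + p * W * Real.exp (-η) := by
            rw [hpW, hW, Finset.sum_mul, ← Finset.sum_sub_distrib, ← Finset.sum_add_distrib]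
            exact Finset.sum_congr rfl fun i _ => by ring
        _ = W * (1 - p + p * Real.exp (-η)) := by ring
        _ ≤ _ := mul_le_mul_of_nonneg_left
            (affine_exp_neg_le η (roundLoss_nonneg _ _) (roundLoss_le_one _ _)) hWpos.le
    have hih := ih (hist ++ [z])
    rw [List.append_assoc, List.singleton_append] at hih
    refine hih.trans ((mul_le_mul_of_nonneg_right hstep (Real.exp_pos _).le).trans_eq ?_)
    rw [mul_assoc, ← Real.exp_add, cumLoss, ← hp, List.length_cons]
    congr 2
    push_cast
    ring

theorem cumLoss_hedge_le [Nonempty ι] {η : ℝ} (hη : 0 < η) (E : ι → RandomizedLearner X Y S)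
    (zs : List (X × S)) (i : ι) :
    cumLoss (hedge η E) [] zs ≤
      cumLoss (E i) [] zs + Real.log (Fintype.card ι) / η + η / 4 * zs.length := by
  have h := sum_exp_hedge_le η E zs []
  have hi := Finset.single_le_sum (f := fun i => Real.exp (-η * cumLoss (E i) [] zs))
    (fun j _ => (Real.exp_pos _).le) (Finset.mem_univ i)
  simp only [List.nil_append] at h
  have hcard : (0 : ℝ) < Fintype.card ι := by exact_mod_cast Fintype.card_pos
  have h2 := hi.trans h
  simp only [cumLoss, mul_zero, Real.exp_zero, Finset.sum_const, Finset.card_univ, nsmul_eq_mul,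
    mul_one] at h2
  rw [← Real.exp_log hcard, ← Real.exp_add, Real.exp_le_exp] at h2
  have h3 : η * cumLoss (hedge η E) [] zs ≤
      η * (cumLoss (E i) [] zs + Real.log (Fintype.card ι) / η + η / 4 * zs.length) := by
    have : η * (Real.log (Fintype.card ι) / η) = Real.log (Fintype.card ι) := by field_simp
    rw [mul_add, mul_add, this]
    linarith
  exact le_of_mul_le_mul_left h3 hη

end Hedge

/-! ### The agnostic learner -/

section Agnostic

variable {X Y : Type*} [Fintype Y] [Nonempty Y] {S : Set (Set Y)}

theorem exists_function_of_card_le {T d : ℕ} (L : Finset ℕ) (hL : ∀ t ∈ L, t < T)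
    (hc : L.card ≤ d) :
    ∃ e : Fin d → Fin (T + 1), {t | t < T ∧ ∃ i, (e i : ℕ) = t} = (L : Set ℕ) := by
  -- The value `T` marks an unused slot; the condition `t < T` discards it.
  have hlt : ∀ i, L.toList.getD i T < T + 1 := by
    intro i
    by_cases hi : i < L.toList.length
    · rw [List.getD_eq_getElem _ _ hi]
      have := hL _ (Finset.mem_toList.1 (List.getElem_mem hi))
      omega
    · rw [List.getD_eq_default _ _ (not_lt.1 hi)]
      omega
  refine ⟨fun i => ⟨L.toList.getD i T, hlt i⟩, ?_⟩
  ext t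
  simp only [Set.mem_ofPred_eq, Finset.mem_coe]
  constructor
  · rintro ⟨ht, i, hi⟩
    by_cases hil : (i : ℕ) < L.toList.length
    · rw [List.getD_eq_getElem _ _ hil] at hi
      rw [← hi]
      exact Finset.mem_toList.1 (List.getElem_mem hil)
    · rw [List.getD_eq_default _ _ (not_lt.1 hil)] at hi
      omega
  · intro ht
    obtain ⟨i, hi, hit⟩ := List.mem_iff_getElem.1 (Finset.mem_toList.2 ht)
    refine ⟨hL t ht, ⟨i, by rw [Finset.length_toList] at hi; omega⟩, ?_⟩
    rw [List.getD_eq_getElem _ _ hi, hit]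

theorem exists_updateRounds (hS : HasHellyTwo S) {d : ℕ} {H : Set (X → Y)}
    (hd : ¬ ShatterDepth S (d + 1) H) {h : X → Y} (hh : h ∈ H) (zs : List (X × S)) :
    ∃ L : Finset ℕ, (∀ t ∈ L, t < zs.length) ∧ L.card ≤ d ∧
      cumLoss (soaLearner S H L) [] zs ≤ d + hypLoss h zs := by
  obtain ⟨L, -, hL, hc, hl⟩ := exists_soaLearner_le hS zs [] d ∅ (by simp) hd hh
  exact ⟨L, fun t ht => by simpa using (hL t ht (by simp)).2, by simpa using hc, hl⟩

theorem exists_agnostic_learner (hS : HasHellyTwo S) {d : ℕ} {H : Set (X → Y)}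
    (hd : ¬ ShatterDepth S (d + 1) H) (T : ℕ) :
    ∃ A : RandomizedLearner X Y S, ∀ zs : List (X × S), zs.length = T → ∀ h ∈ H,
      cumLoss A [] zs ≤ d + √(2 * d * T * Real.log T) + hypLoss h zs := by
  -- Short horizons are trivial since the loss is at most `T`, and `d = 0` needs a single expert.
  -- What remains has `T ≥ 2`, hence `T + 1 ≤ T ^ 2`.
  rcases le_or_gt T d with hT | hT
  · refine ⟨soaLearner S H ∅, fun zs hl h _ => ?_⟩
    have h1 := cumLoss_le_length (soaLearner S H ∅) [] zs
    have h2 : (zs.length : ℝ) ≤ d := by exact_mod_cast hl ▸ hT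
    linarith [hypLoss_nonneg h zs, Real.sqrt_nonneg (2 * d * T * Real.log T)]
  rcases Nat.eq_zero_or_pos d with rfl | hd0
  · refine ⟨soaLearner S H ∅, fun zs hl h hh => ?_⟩
    obtain ⟨L, -, hc, hloss⟩ := exists_updateRounds hS hd hh zs
    rw [Finset.card_eq_zero.1 (Nat.le_zero.1 hc), Finset.coe_empty] at hloss
    simpa using hloss
  have hT2 : (2 : ℝ) ≤ T := by exact_mod_cast (by omega : 2 ≤ T)
  have hlog : 0 < Real.log T := Real.log_pos (by linarith)
  have hdpos : (0 : ℝ) < d := by exact_mod_cast hd0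
  have hTpos : (0 : ℝ) < T := by linarith
  set R := √(2 * d * T * Real.log T) with hR
  have hRpos : 0 < R := Real.sqrt_pos.2 (by positivity)
  have hR2 : R ^ 2 = 2 * d * T * Real.log T := Real.sq_sqrt (by positivity)
  -- This rate makes both terms of the hedge bound at most `R / 2`.
  refine ⟨hedge (2 * R / T) fun e : Fin d → Fin (T + 1) =>
    soaLearner S H {t | t < T ∧ ∃ i, (e i : ℕ) = t}, fun zs hl h hh => ?_⟩
  obtain ⟨L, hL, hc, hloss⟩ := exists_updateRounds hS hd hh zs
  obtain ⟨e, he⟩ := exists_function_of_card_le L (hl ▸ hL) hc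
  have hhedge := cumLoss_hedge_le (div_pos (mul_pos two_pos hRpos) hTpos)
    (fun e : Fin d → Fin (T + 1) => soaLearner S H {t | t < T ∧ ∃ i, (e i : ℕ) = t}) zs e
  simp only [he] at hhedge
  have hcard : Real.log (Fintype.card (Fin d → Fin (T + 1))) ≤ 2 * d * Real.log T := by
    have h1 : Real.log ((T : ℝ) + 1) ≤ 2 * Real.log T := by
      have h2 : Real.log ((T : ℝ) ^ 2) = 2 * Real.log T := by rw [Real.log_pow]; norm_num
      rw [← h2]
      exact Real.log_le_log (by positivity) (by nlinarith)
    rw [Fintype.card_fun, Fintype.card_fin, Fintype.card_fin]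
    push_cast
    rw [Real.log_pow]
    nlinarith
  have hfirst : Real.log (Fintype.card (Fin d → Fin (T + 1))) / (2 * R / T) ≤ R / 2 := by
    rw [div_le_iff₀ (by positivity)]
    have : R / 2 * (2 * R / T) = R ^ 2 / T := by ring
    rw [this, hR2]
    refine hcard.trans_eq ?_
    field_simp
  have hsecond : 2 * R / T / 4 * zs.length = R / 2 := by
    rw [hl]
    field_simp
    norm_num
  linarith

end Agnostic

/-! ### The Helly property of ranking sets -/

section Ranking

theorem rankingLoss_eq_zero_iff {K : ℕ} (π : Equiv.Perm (Fin K)) (r : Fin K → Fin 2) :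
    rankingLoss π r = 0 ↔ ∀ i j, r i < r j → ¬ π i < π j := by
  rw [rankingLoss, ← Nat.bot_eq_zero, Finset.sup_eq_bot_iff]
  simp only [Finset.mem_univ, forall_const, Finset.sup_eq_bot_iff]
  refine forall₂_congr fun i j => ?_
  by_cases h1 : r i < r j <;> by_cases h2 : π i < π j <;> simp [h1, h2]

theorem univ_mem_rankingSets (K : ℕ) : Set.univ ∈ rankingSets K := by
  refine ⟨fun _ => 0, ?_⟩
  ext π
  simp [correctRankings, rankingLoss_eq_zero_iff]

/-- Ranking sets that pairwise intersect come from a chain of sets of relevant labels, and a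
permutation that sorts the labels by the number of these sets they belong to is correct for all. -/
theorem hasHellyTwo_rankingSets (K : ℕ) : HasHellyTwo (rankingSets K) := by
  classical
  intro F hF hpair
  set R : Finset (Fin K → Fin 2) := Finset.univ.filter fun r => correctRankings r ∈ F with hR
  set score : Fin K → ℕ := fun i => (R.filter fun r => r i = 1).card with hscore
  -- The order is reversed because relevant labels need small ranks.
  set f : Fin K → ℕᵒᵈ := fun i => OrderDual.toDual (score i) with hf
  refine ⟨(Tuple.sort f).symm, fun B hB => ?_⟩
  obtain ⟨r, rfl⟩ := hF hB
  refine (rankingLoss_eq_zero_iff _ _).2 fun i j hij hlt => ?_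
  have hmono := Tuple.monotone_sort f hlt.le
  simp only [Function.comp_apply, Equiv.apply_symm_apply] at hmono
  have hle : score j ≤ score i := hmono
  refine absurd hle (not_le.2 (Finset.card_lt_card ?_))
  have hi : r i = 0 := by omega
  have hj : r j = 1 := by omega
  refine (Finset.ssubset_iff_of_subset ?_).2
    ⟨r, by simp [hR, hB, hj], by simp [hi]⟩
  intro r' hr'
  rw [Finset.mem_filter] at hr' ⊢
  -- If `r'` contained `i` but not `j`, a ranking correct for both `r` and `r'` would give `i` and
  -- `j` the same rank.
  refine ⟨hr'.1, ?_⟩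
  by_contra hj'
  have hB' : correctRankings r' ∈ F := by simpa [hR] using hr'.1
  obtain ⟨π, h1, h2⟩ := hpair _ hB _ hB'
  have h3 := (rankingLoss_eq_zero_iff _ _).1 h1 i j hij
  have h4 := (rankingLoss_eq_zero_iff _ _).1 h2 j i (by have := hr'.2; omega)
  have : i = j := π.injective (le_antisymm (not_lt.1 h4) (not_lt.1 h3))
  simp [this] at hij

end Ranking

/-! ### Passing between extended and real bounds -/

section Coercions

theorem coe_natCast_div_two (m : ℕ) :
    (((m : ℝ≥0∞) / 2 : ℝ≥0∞) : EReal) = (((m : ℝ) / 2 : ℝ) : EReal) := by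
  have : (m : ℝ≥0∞) / 2 = ENNReal.ofReal ((m : ℝ) / 2) := by
    rw [ENNReal.ofReal_div_of_pos two_pos, ENNReal.ofReal_natCast, ENNReal.ofReal_ofNat]
  rw [this, EReal.coe_ennreal_ofReal, max_eq_left (by positivity)]

theorem ofReal_rpow_half {x : ℝ} (hx : 0 ≤ x) :
    ENNReal.ofReal x ^ (1 / 2 : ℝ) = ENNReal.ofReal √x := by
  rw [ENNReal.ofReal_rpow_of_nonneg hx (by norm_num), Real.sqrt_eq_rpow]

theorem coe_rpow_half_natCast_mul_div (m T : ℕ) :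
    ((((m : ℝ≥0∞) * (T : ℝ≥0∞) / 8) ^ (1 / 2 : ℝ) : ℝ≥0∞) : EReal)
      = ((√((m : ℝ) * T / 8) : ℝ) : EReal) := by
  have : (m : ℝ≥0∞) * (T : ℝ≥0∞) / 8 = ENNReal.ofReal ((m : ℝ) * T / 8) := by
    rw [ENNReal.ofReal_div_of_pos (by norm_num), ENNReal.ofReal_mul (by positivity),
      ENNReal.ofReal_natCast, ENNReal.ofReal_natCast, ENNReal.ofReal_ofNat]
  rw [this, ofReal_rpow_half (by positivity), EReal.coe_ennreal_ofReal,
    max_eq_left (Real.sqrt_nonneg _)]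

theorem coe_natCast_add_rpow_half (d T : ℕ) :
    (((d : ℝ≥0∞) + (2 * (d : ℝ≥0∞) * (T : ℝ≥0∞) * ENNReal.ofReal (Real.log (T : ℝ)))
      ^ (1 / 2 : ℝ) : ℝ≥0∞) : EReal)
      = (((d : ℝ) + √(2 * d * T * Real.log T) : ℝ) : EReal) := by
  have : 2 * (d : ℝ≥0∞) * (T : ℝ≥0∞) * ENNReal.ofReal (Real.log (T : ℝ))
      = ENNReal.ofReal (2 * d * T * Real.log T) := by
    rw [ENNReal.ofReal_mul (by positivity), ENNReal.ofReal_mul (by positivity),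
      ENNReal.ofReal_mul (by positivity), ENNReal.ofReal_natCast, ENNReal.ofReal_natCast,
      ENNReal.ofReal_ofNat]
  have hlog := Real.log_natCast_nonneg T
  rw [this, ofReal_rpow_half (by positivity), ← ENNReal.ofReal_natCast d,
    ← ENNReal.ofReal_add (by positivity) (by positivity), EReal.coe_ennreal_ofReal,
    max_eq_left (by positivity)]

end Coercions

/-! ### Finite and infinite dimension -/

section RankingBounds

variable {X : Type*} [Nonempty X] {K : ℕ} {H : Set (X → Equiv.Perm (Fin K))}

theorem exists_min_rankingDim_eq (hH : H.Nonempty) (T : ℕ) :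
    ∃ m ≤ T, ShatterDepth (rankingSets K) m H ∧
      min (rankingDim H) (T : ℝ≥0∞) = (m : ℝ≥0∞) := by
  have hmin : min (rankingDim H) (T : ℝ≥0∞)
      = ((min (setLittlestoneDim 2 (rankingSets K) H) (T : ℕ∞) : ℕ∞) : ℝ≥0∞) := by
    rw [ENat.toENNReal_min, ENat.toENNReal_coe, rankingDim]
  obtain ⟨m, hm⟩ := ENat.ne_top_iff_exists.1
    (ne_top_of_le_ne_top (ENat.natCast_ne_top T)
      (min_le_right (setLittlestoneDim 2 (rankingSets K) H) (T : ℕ∞)))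
  refine ⟨m, ?_, (le_setLittlestoneDim_iff hH m).1 ?_, ?_⟩
  · exact_mod_cast hm.trans_le (min_le_right _ _)
  · exact hm.trans_le (min_le_left _ _)
  · rw [hmin, ← hm, ENat.toENNReal_coe]

theorem rankingDim_eq_top_or (hH : H.Nonempty) :
    rankingDim H = ⊤ ∨
      ∃ d : ℕ, rankingDim H = d ∧ ¬ ShatterDepth (rankingSets K) (d + 1) H := by
  by_cases htop : setLittlestoneDim 2 (rankingSets K) H = ⊤
  · left; simp [rankingDim, htop]
  · right
    obtain ⟨d, hd⟩ := ENat.ne_top_iff_exists.1 htop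
    refine ⟨d, by rw [rankingDim, ← hd, ENat.toENNReal_coe], fun hs => ?_⟩
    have := (le_setLittlestoneDim_iff hH (d + 1)).2 hs
    rw [← hd] at this
    have : d + 1 ≤ d := by exact_mod_cast this
    omega

end RankingBounds

end SetFeedback

theorem mainTheorem8 {X : Type*} [Nonempty X] (K : ℕ) (H : Set (X → Equiv.Perm (Fin K)))
    (hH : H.Nonempty) (T : ℕ) :
    (((min (SetFeedback.rankingDim H) (T : ℝ≥0∞) / 2 : ℝ≥0∞) : EReal)
        ≤ (⨅ A : SetFeedback.RandomizedLearner X (Equiv.Perm (Fin K)) (SetFeedback.rankingSets K),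
            SetFeedback.mistakes A T H) ∧
      (⨅ A : SetFeedback.RandomizedLearner X (Equiv.Perm (Fin K)) (SetFeedback.rankingSets K),
            SetFeedback.mistakes A T H)
        ≤ ((SetFeedback.rankingDim H : ℝ≥0∞) : EReal)) ∧
    ((((min (SetFeedback.rankingDim H) (T : ℝ≥0∞) * (T : ℝ≥0∞) / 8) ^ (1 / 2 : ℝ) : ℝ≥0∞) : EReal)
        ≤ (⨅ A : SetFeedback.RandomizedLearner X (Equiv.Perm (Fin K)) (SetFeedback.rankingSets K),
            SetFeedback.regret A T H) ∧
      (⨅ A : SetFeedback.RandomizedLearner X (Equiv.Perm (Fin K)) (SetFeedback.rankingSets K),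
            SetFeedback.regret A T H)
        ≤ ((SetFeedback.rankingDim H
            + (2 * SetFeedback.rankingDim H * (T : ℝ≥0∞) * ENNReal.ofReal (Real.log (T : ℝ)))
                ^ (1 / 2 : ℝ) : ℝ≥0∞) : EReal)) := by
  have huniv := SetFeedback.univ_mem_rankingSets K
  have hhelly := SetFeedback.hasHellyTwo_rankingSets K
  refine ⟨⟨?_, ?_⟩, ?_, ?_⟩
  · obtain ⟨m, hmT, hs, hm⟩ := SetFeedback.exists_min_rankingDim_eq hH T
    rw [hm, SetFeedback.coe_natCast_div_two]
    exact le_iInf fun A => SetFeedback.half_le_mistakes huniv hs hmT A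
  · rcases SetFeedback.rankingDim_eq_top_or hH with htop | ⟨d, hd, hs⟩
    · rw [htop, EReal.coe_ennreal_top]
      exact le_top
    · rw [hd, ← ENNReal.ofReal_natCast, EReal.coe_ennreal_ofReal, max_eq_left (by positivity)]
      refine iInf_le_of_le (SetFeedback.soaLearner _ H Set.univ) ?_
      exact SetFeedback.mistakes_le _ fun zs _ h hh hz =>
        SetFeedback.cumLoss_soaLearner_univ_le hhelly zs [] d hs hh hz
  · obtain ⟨m, hmT, hs, hm⟩ := SetFeedback.exists_min_rankingDim_eq hH T
    rw [hm, SetFeedback.coe_rpow_half_natCast_mul_div]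
    exact le_iInf fun A => SetFeedback.sqrt_le_regret huniv hs hmT A
  · rcases SetFeedback.rankingDim_eq_top_or hH with htop | ⟨d, hd, hs⟩
    · rw [htop, top_add, EReal.coe_ennreal_top]
      exact le_top
    · rw [hd, SetFeedback.coe_natCast_add_rpow_half]
      obtain ⟨A, hA⟩ := SetFeedback.exists_agnostic_learner hhelly hs T
      exact iInf_le_of_le A (SetFeedback.regret_le A hH hA)
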